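/- Let $P$ be a $3$-dimensional simplicial convex polytope, i.e. the convex hull of finitely many points in some $\mathbb{R}^m$, with $3$-dimensional affine span, all of whose proper faces are simplices. Let $V(P)$ be its vertex set, $n=|V(P)|$, and let $\Delta(P)$ be its boundary complex, i.e. the simplicial complex of vertex sets of proper faces of $P$ (including the empty face). For $W\subseteq V(P)$ let $P|_W$ be the simplicial complex $\{F\cap W: F\in\Delta(P)\}$. Let $\mathbf{k}$ be an arbitrary field, and define the graded Betti numbers $$\beta_{i,j}(P)=\sum_{W\subseteq V(P),\ |W|=j}\dim_{\mathbf{k}}\widetilde H_{j-i-1}(P|_W;\mathbf{k}),$$ where $\widetilde H$ denotes reduced simplicial homology, and the special graded Betti numbers $b_i(P)=\beta_{i-1,i}(P)$. Then $$n=\frac{7+\sqrt{8\,b_2(P)+1}}{2}\qquad\text{and}\qquad b_2(P)=\binom{n}{2}-3n+6.$$ -/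

import Mathlib

open scoped BigOperators

noncomputable section

/-! ### Reduced simplicial homology

A simplicial complex on vertices in `α` is given by its set `K` of faces (the empty face included).
Homology is computed from the augmented ordered chain complex: in degree `d` it is spanned by the
tuples `(v₀, …, v_d)` of (not necessarily distinct) vertices that span a face of `K`;
degree `-1` is spanned by the empty tuple. -/

namespace SimplicialHomology

variable {α : Type*} (k : Type*) [Field k]

/-- The boundary map `(v₀, …, v_d) ↦ ∑ i, (-1)^i (v₀, …, v̂_i, …, v_d)` on formal combinations of
tuples. On `1`-tuples it is the augmentation, and it kills the empty tuple. -/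
def boundary : (List α →₀ k) →ₗ[k] (List α →₀ k) :=
  Finsupp.linearCombination k fun t : List α =>
    ∑ i ∈ Finset.range t.length, Finsupp.single (t.eraseIdx i) ((-1 : k) ^ i)

theorem boundary_single (t : List α) :
    boundary k (Finsupp.single t 1) =
      ∑ i ∈ Finset.range t.length, Finsupp.single (t.eraseIdx i) ((-1 : k) ^ i) := by
  simp [boundary]

/-- Prepending a vertex to every tuple. -/
def cone (v : α) : (List α →₀ k) →ₗ[k] (List α →₀ k) :=
  Finsupp.lmapDomain k k (List.cons v)

theorem boundary_cone (v : α) (c : List α →₀ k) :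
    boundary k (cone k v c) = c - cone k v (boundary k c) := by
  induction c using Finsupp.induction_linear with
  | zero => simp
  | add f g hf hg => simp only [map_add, hf, hg]; abel
  | single t a =>
    have h : Finsupp.single t a = a • Finsupp.single t (1 : k) := by simp
    rw [h]
    simp only [map_smul, ← smul_sub]
    congr 1
    have h2 : cone k v (Finsupp.single t (1 : k)) = Finsupp.single (v :: t) 1 := by
      simp [cone]
    rw [h2, boundary_single, boundary_single, List.length_cons, Finset.sum_range_succ']
    simp only [cone, List.eraseIdx_cons_succ, List.eraseIdx_cons_zero, pow_zero, map_sum,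
      Finsupp.lmapDomain_apply, Finsupp.mapDomain_single, pow_succ, mul_neg, mul_one,
      Finsupp.single_neg, Finset.sum_neg_distrib]
    abel

/-- The boundary map is a differential. -/
theorem boundary_boundary (c : List α →₀ k) : boundary k (boundary k c) = 0 := by
  induction c using Finsupp.induction_linear with
  | zero => simp
  | add f g hf hg => simp only [map_add, hf, hg, add_zero]
  | single t a =>
    have h : Finsupp.single t a = a • Finsupp.single t (1 : k) := by simp
    rw [h]
    simp only [map_smul]
    suffices h' : boundary k (boundary k (Finsupp.single t (1 : k))) = 0 by rw [h', smul_zero]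
    induction t with
    | nil => simp [boundary_single]
    | cons v t ih =>
      have h2 : Finsupp.single (v :: t) (1 : k) = cone k v (Finsupp.single t 1) := by
        simp [cone]
      rw [h2, boundary_cone, map_sub, boundary_cone, ih (by simp), map_zero, sub_zero, sub_self]

/-- The `d`-chains of `K`: combinations of `(d+1)`-tuples whose entries span a face of `K`. -/
def chains (K : Set (Set α)) (d : ℤ) : Submodule k (List α →₀ k) :=
  Finsupp.supported k k {t : List α | (t.length : ℤ) = d + 1 ∧ {v | v ∈ t} ∈ K}

/-- The (reduced) `d`-cycles of `K`. -/
def cycles (K : Set (Set α)) (d : ℤ) : Submodule k (List α →₀ k) :=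
  chains k K d ⊓ LinearMap.ker (boundary k)

/-- The `d`-boundaries of `K`. -/
def boundaries (K : Set (Set α)) (d : ℤ) : Submodule k (List α →₀ k) :=
  (chains k K (d + 1)).map (boundary k)

/-- The quotient `Z / (Z ∩ B)` of submodules of a vector space (so `Z / B` when `B ⊆ Z`). -/
abbrev Subquotient {M : Type*} [AddCommGroup M] [Module k M] (Z B : Submodule k M) : Type _ :=
  Z ⧸ B.comap Z.subtype

/-- The reduced homology of `K` in degree `d` with coefficients in `k`: cycles modulo boundaries. -/
abbrev ReducedHomology (K : Set (Set α)) (d : ℤ) : Type _ :=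
  Subquotient k (cycles k K d) (boundaries k K d)

end SimplicialHomology

/-- The restriction `{F ∩ W : F ∈ K}` of a simplicial complex to a set `W` of vertices. -/
def restrictComplex {α : Type*} (K : Set (Set α)) (W : Set α) : Set (Set α) :=
  {σ | ∃ F ∈ K, σ = F ∩ W}

/-! ### Convex polytopes -/

/-- A convex polytope: the convex hull of finitely many points. -/
structure ConvexPolytope (E : Type*) [AddCommGroup E] [Module ℝ E] where
  /-- The underlying set of points. -/
  carrier : Set E
  exists_eq_convexHull : ∃ S : Finset E, carrier = convexHull ℝ (S : Set E)

/-- A simplex: the convex hull of finitely many affinely independent points. -/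
def IsGeometricSimplex {E : Type*} [AddCommGroup E] [Module ℝ E] (F : Set E) : Prop :=
  ∃ S : Finset E, AffineIndependent ℝ (fun x : S => (x : E)) ∧ F = convexHull ℝ (S : Set E)

namespace ConvexPolytope

section

variable {E : Type*} [AddCommGroup E] [Module ℝ E]

/-- The dimension of a (nonempty) polytope: the dimension of its affine span. -/
def dim (P : ConvexPolytope E) : ℕ :=
  Module.finrank ℝ (affineSpan ℝ P.carrier).direction

end

variable {E : Type*} [AddCommGroup E] [Module ℝ E] [TopologicalSpace E]

/-- The proper faces of `P`: the empty set and the sets of points of `P` at which some continuous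
linear functional attains its maximum over `P`, other than `P` itself. -/
def IsProperFace (P : ConvexPolytope E) (F : Set E) : Prop :=
  IsExposed ℝ P.carrier F ∧ F ≠ P.carrier

/-- A polytope is simplicial if all of its proper faces are simplices. -/
def IsSimplicial (P : ConvexPolytope E) : Prop :=
  ∀ F : Set E, P.IsProperFace F → IsGeometricSimplex F

theorem finite_exposedPoints (P : ConvexPolytope E) : (P.carrier.exposedPoints ℝ).Finite := by
  obtain ⟨S, hS⟩ := P.exists_eq_convexHull
  refine S.finite_toSet.subset (exposedPoints_subset_extremePoints.trans ?_)
  rw [hS]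
  exact extremePoints_convexHull_subset

/-- The vertex set `V(P)`: the points `v` such that `{v}` is a face of `P`. -/
def vertices (P : ConvexPolytope E) : Finset E :=
  P.finite_exposedPoints.toFinset

/-- The boundary complex `Δ(P)`: the vertex sets of the proper faces of `P`. -/
def boundaryComplex (P : ConvexPolytope E) : Set (Set E) :=
  {σ | ∃ F : Set E, P.IsProperFace F ∧ σ = F ∩ (P.vertices : Set E)}

/-- The graded Betti number
`β_{i,j}(P) = ∑_{W ⊆ V(P), |W| = j} dim_k H̃_{j-i-1}(P|_W; k)`. -/
def gradedBetti (k : Type*) [Field k] (P : ConvexPolytope E) (i : ℤ) (j : ℕ) : ℕ :=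
  ∑ W ∈ P.vertices.powersetCard j,
    Module.finrank k
      (SimplicialHomology.ReducedHomology k
        (restrictComplex P.boundaryComplex (W : Set E)) ((j : ℤ) - i - 1))

/-- The special graded Betti number `b_i(P) = β_{i-1,i}(P)`. -/
def specialBetti (k : Type*) [Field k] (P : ConvexPolytope E) (i : ℕ) : ℕ :=
  P.gradedBetti k ((i : ℤ) - 1) i

end ConvexPolytope

end

/-! ### Faces of finite point configurations -/

/-! A pair of vertices contributes to `b_2` the dimension of the degree-zero reduced homology of its
restriction: 0 if the pair is an edge, 1 otherwise. So `b_2` is the number of pairs minus the number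
of edges, and it remains to find 3n - 6 edges.

Euler's formula is replaced by a sweep. Take a linear functional `l` injective on the vertices. Each
triangle has one middle vertex for `l`, and each vertex other than the lowest and the highest is the
middle of exactly two triangles (`card_triangles_middle`), so there are 2(n - 2) triangles. Each
triangle has three edges and each edge lies in two triangles (`card_triangles_edge`), whence 3n - 6
edges.

Both "exactly two" statements say that a pointed planar cone has two extreme rays:
`exists_extreme_ratios` yields two, `not_three_extreme_rays` excludes a third. The cone is the
quotient by the edge direction in one case, the slice `l = 0` of the cone at the vertex in the
other. -/

section FaceSets

open scoped Classical
open Module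

variable {E : Type*} [AddCommGroup E] [Module ℝ E]

/-- `σ` is a proper subset of `V` on which some linear functional attains its maximum over `V`
(or is empty). -/
def IsFaceSet (V σ : Finset E) : Prop :=
  σ ⊂ V ∧ ∃ (θ : E →ₗ[ℝ] ℝ) (c : ℝ), ∀ x ∈ V, θ x ≤ c ∧ (θ x = c ↔ x ∈ σ)

/-- A finite configuration of points in convex position, with three-dimensional affine span, all of
whose proper faces are affinely independent. -/
structure IsSimplicialConfiguration (V : Finset E) : Prop where
  finrank_vectorSpan : finrank ℝ (vectorSpan ℝ (V : Set E)) = 3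
  affineIndependent : ∀ σ, IsFaceSet V σ → AffineIndependent ℝ (fun x : σ => (x : E))
  isFaceSet_singleton : ∀ v ∈ V, IsFaceSet V {v}

/-- The faces with three vertices. -/
noncomputable def triangles (V : Finset E) : Finset (Finset E) :=
  (V.powersetCard 3).filter (IsFaceSet V)

/-- The faces with two vertices. -/
noncomputable def edges (V : Finset E) : Finset (Finset E) :=
  (V.powersetCard 2).filter (IsFaceSet V)

theorem mem_triangles {V σ : Finset E} : σ ∈ triangles V ↔ IsFaceSet V σ ∧ σ.card = 3 := by
  simp only [triangles, Finset.mem_filter, Finset.mem_powersetCard]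
  exact ⟨fun h => ⟨h.2, h.1.2⟩, fun h => ⟨⟨h.1.1.1, h.2⟩, h.1⟩⟩

theorem mem_edges {V σ : Finset E} : σ ∈ edges V ↔ IsFaceSet V σ ∧ σ.card = 2 := by
  simp only [edges, Finset.mem_filter, Finset.mem_powersetCard]
  exact ⟨fun h => ⟨h.2, h.1.2⟩, fun h => ⟨⟨h.1.1.1, h.2⟩, h.1⟩⟩

theorem IsFaceSet.exists_functional {V σ : Finset E} (h : IsFaceSet V σ) {a : E} (ha : a ∈ σ) :
    ∃ θ : E →ₗ[ℝ] ℝ, ∀ x ∈ V, θ (x - a) ≤ 0 ∧ (θ (x - a) = 0 ↔ x ∈ σ) := by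
  obtain ⟨hσ, θ, c, hθ⟩ := h
  have hc : θ a = c := (hθ a (hσ.1 ha)).2.2 ha
  refine ⟨θ, fun x hx => ?_⟩
  rw [map_sub, hc, sub_nonpos, sub_eq_zero]
  exact hθ x hx

theorem isFaceSet_filter {V : Finset E} {a : E} {θ : E →ₗ[ℝ] ℝ}
    (hθ : ∀ x ∈ V, θ (x - a) ≤ 0) (hne : ∃ x ∈ V, θ (x - a) ≠ 0) :
    IsFaceSet V (V.filter fun x => θ (x - a) = 0) := by
  refine ⟨?_, θ, θ a, fun x hx => ?_⟩
  · rw [Finset.filter_ssubset]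
    exact hne
  · have := hθ x hx
    rw [map_sub, sub_nonpos] at this
    simp [hx, this, sub_eq_zero]

/-- A functional that is constant on `V` vanishes on the direction of its affine span. -/
theorem eq_zero_of_mem_vectorSpan {V : Set E} {a : E} {θ : E →ₗ[ℝ] ℝ}
    (hθ : ∀ x ∈ V, θ (x - a) = 0) {z : E} (hz : z ∈ vectorSpan ℝ V) : θ z = 0 := by
  have : vectorSpan ℝ V ≤ LinearMap.ker θ := by
    refine Submodule.span_le.2 ?_
    rintro _ ⟨x, hx, y, hy, rfl⟩
    have h1 := hθ x hx
    have h2 := hθ y hy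
    rw [map_sub] at h1 h2
    simp only [SetLike.mem_coe, LinearMap.mem_ker, vsub_eq_sub, map_sub]
    linarith
  exact this hz

theorem sub_mem_vectorSpan {V : Finset E} {x y : E} (hx : x ∈ V) (hy : y ∈ V) :
    x - y ∈ vectorSpan ℝ (V : Set E) :=
  vsub_mem_vectorSpan ℝ hx hy

theorem finrank_vectorSpan_add_one_of_affineIndependent {σ : Finset E}
    (h : AffineIndependent ℝ (fun x : σ => (x : E))) (hσ : σ.Nonempty) :
    finrank ℝ (vectorSpan ℝ (σ : Set E)) + 1 = σ.card := by
  have h1 := Finset.card_pos.2 hσ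
  have h2 := h.finrank_vectorSpan (n := σ.card - 1) (by simp; omega)
  rw [Subtype.range_coe_subtype] at h2
  change finrank ℝ (vectorSpan ℝ {x | x ∈ σ}) + 1 = σ.card
  omega

/-! ### Extreme rays of planar cones. -/

/-- Finitely many vectors in an open half-plane, not all on one ray, have two extreme rays. -/
theorem exists_extreme_ratios {ι : Type*} (I : Finset ι) (hI : I.Nonempty) (f g : ι → ℝ)
    (hf : ∀ i ∈ I, f i < 0) (hfg : ∀ r : ℝ, ∃ i ∈ I, g i ≠ r * f i) :
    ∃ r s : ℝ, r ≠ s ∧ (∀ i ∈ I, g i ≤ r * f i) ∧ (∃ i ∈ I, g i = r * f i) ∧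
      (∀ i ∈ I, s * f i ≤ g i) ∧ ∃ i ∈ I, g i = s * f i := by
  obtain ⟨i, hi, hmin⟩ := I.exists_min_image (fun i => g i / f i) hI
  obtain ⟨j, hj, hmax⟩ := I.exists_max_image (fun i => g i / f i) hI
  have key : ∀ k ∈ I, g k = g k / f k * f k := fun k hk => (div_mul_cancel₀ _ (hf k hk).ne).symm
  refine ⟨g i / f i, g j / f j, fun h => ?_, fun k hk => ?_, ⟨i, hi, key i hi⟩, fun k hk => ?_,
    ⟨j, hj, key j hj⟩⟩
  · obtain ⟨k, hk, hne⟩ := hfg (g i / f i)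
    apply hne
    rw [le_antisymm (hmin k hk) (h ▸ hmax k hk)]
    exact key k hk
  · rw [key k hk]
    exact mul_le_mul_of_nonpos_right (hmin k hk) (hf k hk).le
  · conv_rhs => rw [key k hk]
    exact mul_le_mul_of_nonpos_right (hmax k hk) (hf k hk).le

/-- In a three-dimensional space, two functionals have a common zero that a third one detects. -/
theorem exists_common_zero {D : Submodule ℝ E} (hD : finrank ℝ D = 3) (φ l : E →ₗ[ℝ] ℝ) :
    ∃ z ∈ D, ∃ ψ : E →ₗ[ℝ] ℝ, φ z = 0 ∧ l z = 0 ∧ ψ z ≠ 0 := by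
  have : FiniteDimensional ℝ D := FiniteDimensional.of_finrank_pos (by omega)
  have hk : LinearMap.ker ((φ.prod l).comp D.subtype) ≠ ⊥ :=
    LinearMap.ker_ne_bot_of_finrank_lt (by simp [hD])
  obtain ⟨z, hz, hz0⟩ := Submodule.exists_mem_ne_zero_of_ne_bot hk
  obtain ⟨ψ, hψ⟩ := Projective.exists_dual_ne_zero ℝ (x := (z : E)) (by simpa using hz0)
  simp only [LinearMap.mem_ker, LinearMap.comp_apply, Submodule.subtype_apply,
    LinearMap.prod_apply, Function.prod_apply, Prod.mk_eq_zero] at hz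
  exact ⟨z, z.2, ψ, hz.1, hz.2, hψ⟩

/-- A pointed two-dimensional cone does not have three extreme rays. -/
theorem not_three_extreme_rays {D : Submodule ℝ E} (hD : finrank ℝ D = 3) (l : E →ₗ[ℝ] ℝ)
    (hl : ∃ x ∈ D, l x ≠ 0) (θ : Fin 3 → E →ₗ[ℝ] ℝ) (w : Fin 3 → E) (hw : ∀ i, w i ∈ D)
    (hlw : ∀ i, l (w i) = 0) (h0 : ∀ i, θ i (w i) = 0) (hneg : ∀ i j, i ≠ j → θ i (w j) < 0) :
    False := by
  have : FiniteDimensional ℝ D := FiniteDimensional.of_finrank_pos (by omega)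
  have hlt : D ⊓ LinearMap.ker l < D := by
    refine lt_of_le_of_ne inf_le_left fun h => ?_
    obtain ⟨x, hx, hlx⟩ := hl
    rw [← h] at hx
    exact hlx hx.2
  have hrank := Submodule.finrank_lt_finrank_of_lt hlt
  have : FiniteDimensional ℝ (D ⊓ LinearMap.ker l : Submodule ℝ E) :=
    Submodule.finiteDimensional_of_le inf_le_left
  let w' : Fin 3 → (D ⊓ LinearMap.ker l : Submodule ℝ E) := fun i => ⟨w i, hw i, hlw i⟩
  -- The three vectors lie in a space of dimension at most 2. Applying `θ i` to a dependence removes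
  -- its `i`-th term, so the other two coefficients have opposite signs or both vanish.
  have hdep : ¬ LinearIndependent ℝ w' := fun h => by
    have := h.fintype_card_le_finrank
    simp at this
    omega
  obtain ⟨g, hg, i, hi⟩ := Fintype.not_linearIndependent_iff.1 hdep
  have hg' : g 0 • w 0 + g 1 • w 1 + g 2 • w 2 = 0 := by
    have := congrArg (Subtype.val) hg
    simpa [Fin.sum_univ_three, w'] using this
  have e : ∀ i, g 0 * θ i (w 0) + g 1 * θ i (w 1) + g 2 * θ i (w 2) = 0 := fun i => by
    simpa using congrArg (θ i) hg'
  have opp : ∀ {a b p q : ℝ}, p < 0 → q < 0 → a * p + b * q = 0 → a * b ≤ 0 ∧ (b = 0 → a = 0) := by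
    intro a b p q hp hq h
    constructor
    · by_contra! hab
      rcases pos_and_pos_or_neg_and_neg_of_mul_pos hab with ⟨h1, h2⟩ | ⟨h1, h2⟩ <;>
        nlinarith [mul_pos_of_neg_of_neg hp hq]
    · rintro rfl
      have : a * p = 0 := by linarith
      exact (mul_eq_zero.1 this).resolve_right hp.ne
  have e0 := opp (hneg 0 1 (by decide)) (hneg 0 2 (by decide)) (by simpa [h0] using e 0)
  have e1 := opp (hneg 1 0 (by decide)) (hneg 1 2 (by decide)) (by simpa [h0] using e 1)
  have e2 := opp (hneg 2 0 (by decide)) (hneg 2 1 (by decide)) (by simpa [h0] using e 2)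
  -- Three nonzero numbers cannot have pairwise opposite signs: the product of the pairwise products
  -- is a square.
  have hz : g 0 = 0 ∨ g 1 = 0 ∨ g 2 = 0 := by
    by_contra! h
    have h1 := lt_of_le_of_ne e0.1 (mul_ne_zero h.2.1 h.2.2)
    have h2 := lt_of_le_of_ne e1.1 (mul_ne_zero h.1 h.2.2)
    have h3 := lt_of_le_of_ne e2.1 (mul_ne_zero h.1 h.2.1)
    nlinarith [mul_pos (mul_pos_of_neg_of_neg h1 h2) (neg_pos.2 h3),
      sq_nonneg (g 0 * g 1 * g 2)]
  have opp' : ∀ {a b p q : ℝ}, p < 0 → q < 0 → a * p + b * q = 0 → a = 0 → b = 0 :=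
    fun hp hq h => (opp hq hp (by linarith)).2
  have f0 := opp' (hneg 0 1 (by decide)) (hneg 0 2 (by decide)) (by simpa [h0] using e 0)
  have f1 := opp' (hneg 1 0 (by decide)) (hneg 1 2 (by decide)) (by simpa [h0] using e 1)
  have f2 := opp' (hneg 2 0 (by decide)) (hneg 2 1 (by decide)) (by simpa [h0] using e 2)
  have hall : g 0 = 0 ∧ g 1 = 0 ∧ g 2 = 0 := by
    rcases hz with h | h | h
    · exact ⟨h, f2 h, f1 h⟩
    · exact ⟨e2.2 h, h, f0 h⟩
    · exact ⟨e1.2 h, e0.2 h, h⟩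
  fin_cases i
  · exact hi hall.1
  · exact hi hall.2.1
  · exact hi hall.2.2

/-! ### Triangles through a given edge. -/

namespace IsSimplicialConfiguration

variable {V : Finset E}

/-- A nonempty face lies in a supporting hyperplane that misses some point of `V`, so its affine
span has dimension at most 2; affine independence then bounds its size. -/
theorem card_le_three (hV : IsSimplicialConfiguration V) {σ : Finset E} (hσ : IsFaceSet V σ) : σ.card ≤ 3 := by
  rcases σ.eq_empty_or_nonempty with rfl | ⟨s, hs⟩
  · simp
  have hai := hV.affineIndependent σ hσ
  have : FiniteDimensional ℝ (vectorSpan ℝ (V : Set E)) :=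
    FiniteDimensional.of_finrank_pos (by rw [hV.finrank_vectorSpan]; omega)
  obtain ⟨θ, hθ⟩ := hσ.exists_functional hs
  have hlt : vectorSpan ℝ (σ : Set E) < vectorSpan ℝ (V : Set E) := by
    refine lt_of_le_of_ne (vectorSpan_mono ℝ (by exact_mod_cast hσ.1.1)) fun h => ?_
    obtain ⟨x, hx, hxσ⟩ := Finset.exists_of_ssubset hσ.1
    refine hxσ ((hθ x hx).2.1 ?_)
    refine eq_zero_of_mem_vectorSpan (V := (σ : Set E)) (a := s)
      (fun y hy => (hθ y (hσ.1.1 hy)).2.2 hy) ?_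
    rw [h]
    exact sub_mem_vectorSpan hx (hσ.1.1 hs)
  have h1 := Submodule.finrank_lt_finrank_of_lt hlt
  have h2 := finrank_vectorSpan_add_one_of_affineIndependent hai ⟨s, hs⟩
  rw [hV.finrank_vectorSpan] at h1
  omega

theorem exists_triangle (hV : IsSimplicialConfiguration V) {a p q : E} (ha : a ∈ V) (hp : p ∈ V)
    (hq : q ∈ V) (hpq : p ≠ q) (hpa : p ≠ a) (hqa : q ≠ a) {θ : E →ₗ[ℝ] ℝ}
    (hθ : ∀ x ∈ V, θ (x - a) ≤ 0) (hne : ∃ x ∈ V, θ (x - a) ≠ 0) (hθp : θ (p - a) = 0)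
    (hθq : θ (q - a) = 0) : {a, p, q} ∈ triangles V := by
  have hf := isFaceSet_filter hθ hne
  have hsub : ({a, p, q} : Finset E) ⊆ V.filter fun x => θ (x - a) = 0 := by
    intro x hx
    simp only [Finset.mem_insert, Finset.mem_singleton] at hx
    rcases hx with rfl | rfl | rfl <;> simp [-map_sub, *]
  have hcard : ({a, p, q} : Finset E).card = 3 :=
    Finset.card_eq_three.2 ⟨a, p, q, hpa.symm, hqa.symm, hpq, rfl⟩
  have heq := Finset.eq_of_subset_of_card_le hsub (by rw [hcard]; exact hV.card_le_three hf)
  rw [mem_triangles, heq]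
  exact ⟨hf, heq ▸ hcard⟩

/-- Modulo `b - a` the span is a plane with coordinates `φ`, `ψ`, and the other points lie in the
half-plane `φ < 0`. The two extreme rays give supporting functionals `ψ - r • φ` and `-(ψ - s • φ)`,
each cutting out a triangle. -/
theorem two_le_triangles_edge (hV : IsSimplicialConfiguration V) {a b : E} (hab : a ≠ b)
    (he : IsFaceSet V {a, b}) :
    2 ≤ ((triangles V).filter fun σ => {a, b} ⊆ σ).card := by
  have ha : a ∈ V := he.1.1 (by simp)
  have hb : b ∈ V := he.1.1 (by simp)
  obtain ⟨φ, hφ⟩ := he.exists_functional (a := a) (by simp)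
  have hφb : φ (b - a) = 0 := (hφ b hb).2.2 (by simp)
  obtain ⟨l, hl⟩ := Projective.exists_dual_ne_zero ℝ (sub_ne_zero.2 hab.symm)
  obtain ⟨z, hzD, ψ₀, hφz, hlz, hψz⟩ := exists_common_zero hV.finrank_vectorSpan φ l
  -- The correction makes `ψ` kill `b - a` and leaves its value at `z` unchanged, since `l z = 0`.
  set ψ : E →ₗ[ℝ] ℝ := ψ₀ - (ψ₀ (b - a) / l (b - a)) • l with hψ
  have hψb : ψ (b - a) = 0 := by
    simp only [hψ, LinearMap.sub_apply, LinearMap.smul_apply, smul_eq_mul]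
    rw [div_mul_cancel₀ _ hl, sub_self]
  have hψz' : ψ z ≠ 0 := by simpa [hψ, hlz] using hψz
  have hnp : ∀ r : ℝ, ∃ x ∈ V, (ψ - r • φ) (x - a) ≠ 0 := by
    intro r
    by_contra! h
    have := eq_zero_of_mem_vectorSpan (V := (V : Set E)) h hzD
    simp [hφz, hψz'] at this
  have hI : ∀ {x}, x ∈ V \ {a, b} → x ∈ V ∧ x ≠ a ∧ x ≠ b ∧ φ (x - a) < 0 := by
    intro x hx
    simp only [Finset.mem_sdiff, Finset.mem_insert, Finset.mem_singleton, not_or] at hx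
    refine ⟨hx.1, hx.2.1, hx.2.2, lt_of_le_of_ne (hφ x hx.1).1 fun h => ?_⟩
    have := (hφ x hx.1).2.1 h
    simp [hx.2.1, hx.2.2] at this
  have hV' : ∀ x ∈ V, x = a ∨ x = b ∨ x ∈ V \ {a, b} := by
    intro x hx
    simp only [Finset.mem_sdiff, Finset.mem_insert, Finset.mem_singleton]
    tauto
  obtain ⟨r, s, hrs, hr, ⟨c, hc, hrc⟩, hs, ⟨d, hd, hsd⟩⟩ :=
    exists_extreme_ratios (V \ {a, b}) (by
      obtain ⟨x, hx, hxe⟩ := Finset.exists_of_ssubset he.1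
      exact ⟨x, Finset.mem_sdiff.2 ⟨hx, hxe⟩⟩)
      (fun x => φ (x - a)) (fun x => ψ (x - a)) (fun x hx => (hI hx).2.2.2) (by
      intro r
      obtain ⟨x, hx, hne⟩ := hnp r
      have hne' : ψ (x - a) ≠ r * φ (x - a) := fun h => hne (by simp [-map_sub, h])
      rcases hV' x hx with rfl | rfl | h
      · simp at hne'
      · rw [hφb, hψb] at hne'
        simp at hne'
      · exact ⟨x, h, hne'⟩)
  obtain ⟨hcV, hca, hcb, hφc⟩ := hI hc
  obtain ⟨hdV, hda, hdb, hφd⟩ := hI hd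
  have hcd : c ≠ d := by
    rintro rfl
    exact hrs (mul_right_cancel₀ hφc.ne (hrc.symm.trans hsd))
  have t1 : {a, b, c} ∈ triangles V := by
    refine hV.exists_triangle ha hb hcV hcb.symm hab.symm hca (θ := ψ - r • φ) ?_ (hnp r) ?_ ?_
    · intro x hx
      simp only [LinearMap.sub_apply, LinearMap.smul_apply, smul_eq_mul]
      rcases hV' x hx with rfl | rfl | h
      · simp
      · simp [-map_sub, hφb, hψb]
      · linarith [hr x h]
    · simp [-map_sub, hφb, hψb]
    · simp [-map_sub, hrc]
  have t2 : {a, b, d} ∈ triangles V := by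
    refine hV.exists_triangle ha hb hdV hdb.symm hab.symm hda (θ := -(ψ - s • φ)) ?_ ?_ ?_ ?_
    · intro x hx
      simp only [LinearMap.sub_apply, LinearMap.smul_apply, smul_eq_mul, LinearMap.neg_apply]
      rcases hV' x hx with rfl | rfl | h
      · simp
      · simp [-map_sub, hφb, hψb]
      · linarith [hs x h]
    · obtain ⟨x, hx, h⟩ := hnp s
      exact ⟨x, hx, by rw [LinearMap.neg_apply]; exact neg_ne_zero.2 h⟩
    · simp [-map_sub, hφb, hψb]
    · simp [-map_sub, hsd]
  have hsub : ({{a, b, c}, {a, b, d}} : Finset (Finset E)) ⊆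
      (triangles V).filter fun σ => {a, b} ⊆ σ := by
    intro σ hσ
    simp only [Finset.mem_insert, Finset.mem_singleton] at hσ
    rcases hσ with rfl | rfl
    · exact Finset.mem_filter.2 ⟨t1, by simp [Finset.insert_subset_iff]⟩
    · exact Finset.mem_filter.2 ⟨t2, by simp [Finset.insert_subset_iff]⟩
  refine le_trans (le_of_eq (Finset.card_pair fun h => ?_).symm) (Finset.card_le_card hsub)
  have : c ∈ ({a, b, d} : Finset E) := h ▸ by simp
  simp [hca, hcb, hcd] at this

/-- Project the third vertex of each triangle into `l = 0` along `b - a`. The supporting functional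
of a triangle vanishes on its own projection and is negative on the others, so three triangles would
give three extreme rays. -/
theorem triangles_edge_le_two (hV : IsSimplicialConfiguration V) {a b : E} (hab : a ≠ b) :
    ((triangles V).filter fun σ => {a, b} ⊆ σ).card ≤ 2 := by
  by_contra! h
  obtain ⟨σ₀, h₀, σ₁, h₁, σ₂, h₂, h01, h02, h12⟩ := Finset.two_lt_card.1 h
  let σ : Fin 3 → Finset E := ![σ₀, σ₁, σ₂]
  have hσ : ∀ i, σ i ∈ (triangles V).filter fun σ => {a, b} ⊆ σ := by
    intro i; fin_cases i <;> assumption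
  have hinj : ∀ i j, i ≠ j → σ i ≠ σ j := by
    intro i j hij
    fin_cases i <;> fin_cases j <;> first | exact absurd rfl hij | assumption | (symm; assumption)
  simp only [Finset.mem_filter, mem_triangles] at hσ
  have haσ : ∀ i, a ∈ σ i := fun i => (hσ i).2 (by simp)
  have hbσ : ∀ i, b ∈ σ i := fun i => (hσ i).2 (by simp)
  have hc : ∀ i, ∃ c ∈ σ i, σ i = {a, b, c} := by
    intro i
    obtain ⟨c, hc, hcab⟩ := Finset.exists_mem_notMem_of_card_lt_card
      (s := {a, b}) (t := σ i) (by rw [Finset.card_pair hab, (hσ i).1.2]; omega)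
    simp only [Finset.mem_insert, Finset.mem_singleton, not_or] at hcab
    refine ⟨c, hc, (Finset.eq_of_subset_of_card_le ?_ ?_).symm⟩
    · simp [Finset.insert_subset_iff, haσ, hbσ, hc]
    · rw [(hσ i).1.2]
      exact (Finset.card_eq_three.2
        ⟨a, b, c, hab, Ne.symm hcab.1, Ne.symm hcab.2, rfl⟩).ge
  choose c hcσ hc using hc
  choose θ hθ using fun i => (hσ i).1.1.exists_functional (haσ i)
  obtain ⟨l, hl⟩ := Projective.exists_dual_ne_zero ℝ (sub_ne_zero.2 hab.symm)
  have hmem : ∀ i, ∀ x ∈ σ i, x ∈ V := fun i x hx => (hσ i).1.1.1.1 hx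
  have hθb : ∀ i, θ i (b - a) = 0 := fun i =>
    (hθ i b (hmem i b (hbσ i))).2.2 (hbσ i)
  have hbD := sub_mem_vectorSpan (hmem 0 b (hbσ 0)) (hmem 0 a (haσ 0))
  refine not_three_extreme_rays hV.finrank_vectorSpan l ⟨b - a, hbD, hl⟩ θ
    (fun i => (c i - a) - (l (c i - a) / l (b - a)) • (b - a)) (fun i => ?_) (fun i => ?_)
    (fun i => ?_) (fun i j hij => ?_)
  · exact Submodule.sub_mem _ (sub_mem_vectorSpan (hmem i _ (hcσ i)) (hmem 0 a (haσ 0)))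
      (Submodule.smul_mem _ _ hbD)
  · rw [map_sub, map_smul, smul_eq_mul, div_mul_cancel₀ _ hl, sub_self]
  · rw [map_sub, map_smul, hθb, smul_zero, sub_zero]
    exact (hθ i _ (hmem i _ (hcσ i))).2.2 (hcσ i)
  · rw [map_sub, map_smul, hθb, smul_zero, sub_zero]
    refine lt_of_le_of_ne (hθ i _ (hmem j _ (hcσ j))).1 fun h => ?_
    have hm := (hθ i _ (hmem j _ (hcσ j))).2.1 h
    refine hinj j i hij.symm (Finset.eq_of_subset_of_card_le ?_ ?_)
    · rw [hc j]
      simp [Finset.insert_subset_iff, haσ, hbσ, hm]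
    · rw [(hσ i).1.2, (hσ j).1.2]

/-- Every edge lies in exactly two triangles. -/
theorem card_triangles_edge (hV : IsSimplicialConfiguration V) {e : Finset E} (he : e ∈ edges V) :
    ((triangles V).filter fun σ => e ⊆ σ).card = 2 := by
  rw [mem_edges] at he
  obtain ⟨a, b, hab, rfl⟩ := Finset.card_eq_two.1 he.2
  exact le_antisymm (hV.triangles_edge_le_two hab) (hV.two_le_triangles_edge hab he.1)

end IsSimplicialConfiguration

/-! ### Triangles with a given middle vertex. -/

/-- The points of `S` that neither minimise nor maximise `l` on `S`. -/
noncomputable def middlePoints (l : E →ₗ[ℝ] ℝ) (S : Finset E) : Finset E :=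
  S.filter fun v => (∃ a ∈ S, l a < l v) ∧ ∃ b ∈ S, l v < l b

theorem card_middlePoints {l : E →ₗ[ℝ] ℝ} {S : Finset E} (hl : Set.InjOn l S)
    (hS : 2 ≤ S.card) : (middlePoints l S).card + 2 = S.card := by
  have hne : S.Nonempty := Finset.card_pos.1 (by omega)
  obtain ⟨m, hm, hmin⟩ := S.exists_min_image l hne
  obtain ⟨M, hM, hmax⟩ := S.exists_max_image l hne
  have hmM : M ≠ m := by
    rintro rfl
    obtain ⟨x, hx, y, hy, hxy⟩ := Finset.one_lt_card.1 hS
    refine hxy (hl hx hy (le_antisymm ?_ ?_)) <;>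
      linarith [hmin x hx, hmin y hy, hmax x hx, hmax y hy]
  have : middlePoints l S = (S.erase m).erase M := by
    ext v
    simp only [middlePoints, Finset.mem_filter, Finset.mem_erase]
    constructor
    · rintro ⟨hv, ⟨a, ha, hav⟩, b, hb, hvb⟩
      refine ⟨?_, ?_, hv⟩
      · rintro rfl; exact absurd hvb (hmax b hb).not_gt
      · rintro rfl; exact absurd hav (hmin a ha).not_gt
    · rintro ⟨hvM, hvm, hv⟩
      exact ⟨hv, ⟨m, hm, lt_of_le_of_ne (hmin v hv) fun h => hvm (hl hv hm h.symm)⟩,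
        M, hM, lt_of_le_of_ne (hmax v hv) fun h => hvM (hl hv hM h)⟩
  rw [this, Finset.card_erase_of_mem (Finset.mem_erase.2 ⟨hmM, hM⟩), Finset.card_erase_of_mem hm]
  omega

namespace IsSimplicialConfiguration

variable {V : Finset E}

/-- A functional that is nonpositive on the section `l = 0` of the cone of `V` at `v` extends to a
supporting functional of `V` at `v`. -/
theorem exists_middle_triangle (hV : IsSimplicialConfiguration V) {v a b : E} (hv : v ∈ V)
    (ha : a ∈ V) (hb : b ∈ V) {l : E →ₗ[ℝ] ℝ} (hl : Set.InjOn l V)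
    (hav : l (a - v) < 0) (hbv : 0 < l (b - v)) {θ : E →ₗ[ℝ] ℝ}
    (hθ : ∀ x ∈ V, ∀ y ∈ V, l (x - v) < 0 → 0 < l (y - v) →
      θ (l (y - v) • (x - v) - l (x - v) • (y - v)) ≤ 0)
    (hθab : θ (l (b - v) • (a - v) - l (a - v) • (b - v)) = 0)
    (hθz : ∃ z ∈ vectorSpan ℝ (V : Set E), l z = 0 ∧ θ z ≠ 0) :
    {v, a, b} ∈ triangles V := by
  simp only [map_sub θ, map_smul, smul_eq_mul] at hθ hθab
  simp only [← map_sub θ] at hθ hθab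
  have hva : a ≠ v := by rintro rfl; simp at hav
  have hvb : b ≠ v := by rintro rfl; simp at hbv
  have hab : a ≠ b := by rintro rfl; linarith
  -- With this slope `θ - t • l` vanishes at `a - v`, hence by `hθab` at `b - v`. Pairing a point
  -- below `v` with `b`, or one above with `a`, shows that it is nonpositive everywhere.
  set t := θ (a - v) / l (a - v) with ht
  have hta : θ (a - v) = t * l (a - v) := by rw [ht, div_mul_cancel₀ _ hav.ne]
  have htb : θ (b - v) = t * l (b - v) := by
    apply mul_left_cancel₀ hav.ne
    rw [hta] at hθab
    linarith
  refine hV.exists_triangle hv ha hb hab hva hvb (θ := θ - t • l) ?_ ?_ ?_ ?_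
  · intro x hx
    simp only [LinearMap.sub_apply, LinearMap.smul_apply, smul_eq_mul]
    rcases lt_trichotomy (l (x - v)) 0 with h | h | h
    · have h1 := hθ x hx b hb h hbv
      rw [htb] at h1
      by_contra! h2
      have := mul_pos hbv h2
      linarith
    · have : x = v := hl hx hv (by rwa [map_sub, sub_eq_zero] at h)
      simp [this]
    · have h1 := hθ a ha x hx hav h
      rw [hta] at h1
      by_contra! h2
      have := mul_neg_of_neg_of_pos hav h2
      linarith
  · by_contra! h
    obtain ⟨z, hz, hlz, hθz⟩ := hθz
    have := eq_zero_of_mem_vectorSpan (V := (V : Set E)) h hz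
    simp [hlz, hθz] at this
  · simp [-map_sub, hta]
  · simp [-map_sub, htb]

theorem two_le_triangles_middle (hV : IsSimplicialConfiguration V) {l : E →ₗ[ℝ] ℝ}
    (hl : Set.InjOn l V) {v : E} (hv : v ∈ middlePoints l V) :
    2 ≤ ((triangles V).filter fun σ => v ∈ middlePoints l σ).card := by
  simp only [middlePoints, Finset.mem_filter] at hv ⊢
  obtain ⟨hvV, ⟨a₀, ha₀, hav₀⟩, b₀, hb₀, hbv₀⟩ := hv
  obtain ⟨φ, hφ⟩ := (hV.isFaceSet_singleton v hvV).exists_functional (a := v) (by simp)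
  have hφ' : ∀ x ∈ V, l (x - v) ≠ 0 → φ (x - v) < 0 := by
    intro x hx h
    refine lt_of_le_of_ne (hφ x hx).1 fun h0 => h ?_
    have := (hφ x hx).2.1 h0
    rw [Finset.mem_singleton] at this
    simp [this]
  obtain ⟨z, hzD, ψ, hφz, hlz, hψz⟩ := exists_common_zero hV.finrank_vectorSpan φ l
  -- For `p.1` below `v` and `p.2` above it, `w p` is a positive multiple of the vector from `v` to
  -- the point where the segment between them meets the level of `v`.
  let w : E × E → E := fun p => l (p.2 - v) • (p.1 - v) - l (p.1 - v) • (p.2 - v)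
  have hw : ∀ (χ : E →ₗ[ℝ] ℝ) (p : E × E),
      χ (w p) = l (p.2 - v) * χ (p.1 - v) - l (p.1 - v) * χ (p.2 - v) := by
    intro χ p
    simp only [w, map_sub χ, map_smul, smul_eq_mul]
  let A := V.filter fun x => l (x - v) < 0
  let B := V.filter fun x => 0 < l (x - v)
  have hA : ∀ {x}, x ∈ A ↔ x ∈ V ∧ l (x - v) < 0 := Finset.mem_filter
  have hB : ∀ {x}, x ∈ B ↔ x ∈ V ∧ 0 < l (x - v) := Finset.mem_filter
  have ha₀' : a₀ ∈ A := hA.2 ⟨ha₀, by rw [map_sub]; linarith⟩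
  have hb₀' : b₀ ∈ B := hB.2 ⟨hb₀, by rw [map_sub]; linarith⟩
  have hφw : ∀ p ∈ A ×ˢ B, φ (w p) < 0 := by
    intro p hp
    obtain ⟨⟨h1, h2⟩, h3, h4⟩ := (Finset.mem_product.1 hp).imp hA.1 hB.1
    rw [hw]
    have := mul_pos_of_neg_of_neg h2 (hφ' _ h3 h4.ne')
    have := mul_neg_of_pos_of_neg h4 (hφ' _ h1 h2.ne)
    linarith
  -- If `ψ - r • φ` vanished on all crossings, it would be a multiple of `l` on the span; but at `z`
  -- both `φ` and `l` vanish and `ψ` does not.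
  have hnp : ∀ r : ℝ, ∃ p ∈ A ×ˢ B, ψ (w p) ≠ r * φ (w p) := by
    intro r
    by_contra! h
    have h' : ∀ x ∈ A, ∀ y ∈ B,
        l (y - v) * (ψ - r • φ) (x - v) = l (x - v) * (ψ - r • φ) (y - v) := by
      intro x hx y hy
      have := h (x, y) (Finset.mem_product.2 ⟨hx, hy⟩)
      rw [hw, hw] at this
      simp only [LinearMap.sub_apply, LinearMap.smul_apply, smul_eq_mul]
      linarith
    set t := (ψ - r • φ) (a₀ - v) / l (a₀ - v) with ht
    have hta : (ψ - r • φ) (a₀ - v) = t * l (a₀ - v) := by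
      rw [ht, div_mul_cancel₀ _ (hA.1 ha₀').2.ne]
    have htB : ∀ y ∈ B, (ψ - r • φ) (y - v) = t * l (y - v) := by
      intro y hy
      apply mul_left_cancel₀ (hA.1 ha₀').2.ne
      rw [← h' a₀ ha₀' y hy, hta]
      ring
    have htA : ∀ x ∈ A, (ψ - r • φ) (x - v) = t * l (x - v) := by
      intro x hx
      apply mul_left_cancel₀ (hB.1 hb₀').2.ne'
      rw [h' x hx b₀ hb₀', htB b₀ hb₀']
      ring
    have : (ψ - r • φ - t • l) z = 0 := by
      refine eq_zero_of_mem_vectorSpan (V := (V : Set E)) (a := v) (fun x hx => ?_) hzD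
      rw [LinearMap.sub_apply, LinearMap.smul_apply, smul_eq_mul, sub_eq_zero]
      rcases lt_trichotomy (l (x - v)) 0 with h | h | h
      · exact htA x (hA.2 ⟨hx, h⟩)
      · have : x = v := hl hx hvV (by rwa [map_sub, sub_eq_zero] at h)
        simp [this]
      · exact htB x (hB.2 ⟨hx, h⟩)
    simp [hφz, hlz, hψz] at this
  obtain ⟨r, s, hrs, hr, ⟨p, hp, hrp⟩, hs, ⟨q, hq, hsq⟩⟩ :=
    exists_extreme_ratios (A ×ˢ B) ⟨(a₀, b₀), Finset.mem_product.2 ⟨ha₀', hb₀'⟩⟩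
      (fun p => φ (w p)) (fun p => ψ (w p)) hφw hnp
  have hpq : p ≠ q := by
    rintro rfl
    exact hrs (mul_right_cancel₀ (hφw p hp).ne (hrp.symm.trans hsq))
  obtain ⟨⟨hp1, hp1'⟩, hp2, hp2'⟩ := (Finset.mem_product.1 hp).imp hA.1 hB.1
  obtain ⟨⟨hq1, hq1'⟩, hq2, hq2'⟩ := (Finset.mem_product.1 hq).imp hA.1 hB.1
  have t1 : {v, p.1, p.2} ∈ triangles V := by
    refine hV.exists_middle_triangle hvV hp1 hp2 hl hp1' hp2' (θ := ψ - r • φ) ?_ ?_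
      ⟨z, hzD, hlz, by simpa [hφz] using hψz⟩
    · intro x hx y hy hxv hyv
      have := hr (x, y) (Finset.mem_product.2 ⟨hA.2 ⟨hx, hxv⟩, hB.2 ⟨hy, hyv⟩⟩)
      change (ψ - r • φ) (w (x, y)) ≤ 0
      simpa [-map_sub] using this
    · change (ψ - r • φ) (w p) = 0
      simp [-map_sub, hrp]
  have t2 : {v, q.1, q.2} ∈ triangles V := by
    refine hV.exists_middle_triangle hvV hq1 hq2 hl hq1' hq2' (θ := -(ψ - s • φ)) ?_ ?_
      ⟨z, hzD, hlz, by simpa [hφz] using hψz⟩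
    · intro x hx y hy hxv hyv
      have := hs (x, y) (Finset.mem_product.2 ⟨hA.2 ⟨hx, hxv⟩, hB.2 ⟨hy, hyv⟩⟩)
      change (-(ψ - s • φ)) (w (x, y)) ≤ 0
      simpa [-map_sub] using this
    · change (-(ψ - s • φ)) (w q) = 0
      simp [-map_sub, hsq]
  have hsub : ({{v, p.1, p.2}, {v, q.1, q.2}} : Finset (Finset E)) ⊆ (triangles V).filter
      fun σ => v ∈ σ ∧ (∃ a ∈ σ, l a < l v) ∧ ∃ b ∈ σ, l v < l b := by
    rw [map_sub] at hp1' hp2' hq1' hq2'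
    intro σ hσ
    simp only [Finset.mem_insert, Finset.mem_singleton] at hσ
    rcases hσ with rfl | rfl
    · exact Finset.mem_filter.2 ⟨t1, by simp, ⟨p.1, by simp, by linarith⟩,
        p.2, by simp, by linarith⟩
    · exact Finset.mem_filter.2 ⟨t2, by simp, ⟨q.1, by simp, by linarith⟩,
        q.2, by simp, by linarith⟩
  refine le_trans (le_of_eq (Finset.card_pair fun h => hpq ?_).symm) (Finset.card_le_card hsub)
  have e1 : p.1 ∈ ({v, q.1, q.2} : Finset E) := h ▸ by simp
  have e2 : p.2 ∈ ({v, q.1, q.2} : Finset E) := h ▸ by simp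
  simp only [Finset.mem_insert, Finset.mem_singleton] at e1 e2
  refine Prod.ext ?_ ?_
  · rcases e1 with h | h | h
    · rw [h] at hp1'; simp at hp1'
    · exact h
    · rw [h] at hp1'; linarith
  · rcases e2 with h | h | h
    · rw [h] at hp2'; simp at hp2'
    · rw [h] at hp2'; linarith
    · exact h

/-- Each such triangle gives a crossing vector in the slice `l = 0`. If `θ i` vanished on that of
another triangle `σ j`, both `a j` and `b j` would lie in `σ i`, forcing `σ j = σ i`. Hence three
triangles would give three extreme rays. -/
theorem triangles_middle_le_two (hV : IsSimplicialConfiguration V) {l : E →ₗ[ℝ] ℝ} {v : E} :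
    ((triangles V).filter fun σ => v ∈ middlePoints l σ).card ≤ 2 := by
  by_contra! h
  obtain ⟨σ₀, h₀, σ₁, h₁, σ₂, h₂, h01, h02, h12⟩ := Finset.two_lt_card.1 h
  let σ : Fin 3 → Finset E := ![σ₀, σ₁, σ₂]
  have hσ : ∀ i, σ i ∈ (triangles V).filter fun σ => v ∈ middlePoints l σ := by
    intro i; fin_cases i <;> assumption
  have hinj : ∀ i j, i ≠ j → σ i ≠ σ j := by
    intro i j hij
    fin_cases i <;> fin_cases j <;> first | exact absurd rfl hij | assumption | (symm; assumption)
  simp only [Finset.mem_filter, mem_triangles, middlePoints] at hσ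
  have hvσ : ∀ i, v ∈ σ i := fun i => (hσ i).2.1
  choose a haσ ha using fun i => (hσ i).2.2.1
  choose b hbσ hb using fun i => (hσ i).2.2.2
  have ha' : ∀ i, l (a i - v) < 0 := fun i => by rw [map_sub]; linarith [ha i]
  have hb' : ∀ i, 0 < l (b i - v) := fun i => by rw [map_sub]; linarith [hb i]
  have hc : ∀ i, σ i = {v, a i, b i} := by
    intro i
    refine (Finset.eq_of_subset_of_card_le ?_ ?_).symm
    · simp [Finset.insert_subset_iff, haσ, hbσ, hvσ]
    · rw [(hσ i).1.2]
      refine (Finset.card_eq_three.2 ⟨v, a i, b i, ?_, ?_, ?_, rfl⟩).ge <;> intro h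
      · exact absurd (ha i) (by rw [← h]; exact lt_irrefl _)
      · exact absurd (hb i) (by rw [← h]; exact lt_irrefl _)
      · exact absurd ((ha i).trans (hb i)) (by rw [h]; exact lt_irrefl _)
  choose θ hθ using fun i => (hσ i).1.1.exists_functional (hvσ i)
  have hmem : ∀ i, ∀ x ∈ σ i, x ∈ V := fun i x hx => (hσ i).1.1.1.1 hx
  have hvV := hmem 0 v (hvσ 0)
  have hw : ∀ (χ : E →ₗ[ℝ] ℝ) i, χ (l (b i - v) • (a i - v) - l (a i - v) • (b i - v)) =
      l (b i - v) * χ (a i - v) - l (a i - v) * χ (b i - v) := by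
    intro χ i
    simp only [map_sub χ, map_smul, smul_eq_mul]
  refine not_three_extreme_rays hV.finrank_vectorSpan l
    ⟨b 0 - v, sub_mem_vectorSpan (hmem 0 _ (hbσ 0)) hvV, (hb' 0).ne'⟩ θ
    (fun i => l (b i - v) • (a i - v) - l (a i - v) • (b i - v)) (fun i => ?_) (fun i => ?_)
    (fun i => ?_) (fun i j hij => ?_)
  · exact Submodule.sub_mem _
      (Submodule.smul_mem _ _ (sub_mem_vectorSpan (hmem i _ (haσ i)) hvV))
      (Submodule.smul_mem _ _ (sub_mem_vectorSpan (hmem i _ (hbσ i)) hvV))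
  · rw [hw]
    ring
  · rw [hw, (hθ i _ (hmem i _ (haσ i))).2.2 (haσ i), (hθ i _ (hmem i _ (hbσ i))).2.2 (hbσ i)]
    simp
  · rw [hw]
    have h1 := hθ i _ (hmem j _ (haσ j))
    have h2 := hθ i _ (hmem j _ (hbσ j))
    have h3 := mul_nonpos_of_nonneg_of_nonpos (hb' j).le h1.1
    have h4 := mul_nonneg_of_nonpos_of_nonpos (ha' j).le h2.1
    refine lt_of_le_of_ne (by linarith) fun h => ?_
    have h5 : l (b j - v) * θ i (a j - v) = 0 := by linarith
    have h6 : l (a j - v) * θ i (b j - v) = 0 := by linarith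
    have h7 := h1.2.1 ((mul_eq_zero.1 h5).resolve_left (hb' j).ne')
    have h8 := h2.2.1 ((mul_eq_zero.1 h6).resolve_left (ha' j).ne)
    refine hinj j i hij.symm (Finset.eq_of_subset_of_card_le ?_ ?_)
    · rw [hc j]
      simp [Finset.insert_subset_iff, hvσ, h7, h8]
    · rw [(hσ i).1.2, (hσ j).1.2]

/-- Every pair of vertices of a face is an edge. -/
theorem isFaceSet_pair (hV : IsSimplicialConfiguration V) {σ : Finset E} (hσ : IsFaceSet V σ)
    {a b : E} (ha : a ∈ σ) (hb : b ∈ σ) (hab : a ≠ b) : IsFaceSet V {a, b} := by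
  have hsub : ({a, b} : Finset E) ⊆ σ := by simp [Finset.insert_subset_iff, ha, hb]
  rcases hsub.eq_or_ssubset with h | hss
  · rwa [h]
  obtain ⟨c, hc, hcab⟩ := Finset.exists_of_ssubset hss
  have hcab' := hcab
  simp only [Finset.mem_insert, Finset.mem_singleton, not_or] at hcab'
  have hσ3 : σ = {a, b, c} := by
    refine (Finset.eq_of_subset_of_card_le ?_ ?_).symm
    · simp [Finset.insert_subset_iff, ha, hb, hc]
    · rw [Finset.card_eq_three.2 ⟨a, b, c, hab, Ne.symm hcab'.1, Ne.symm hcab'.2, rfl⟩]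
      exact hV.card_le_three hσ
  have hnot : c - a ∉ Submodule.span ℝ {b - a} := by
    intro hmem
    obtain ⟨t, ht⟩ := Submodule.mem_span_singleton.1 hmem
    have hcol : Collinear ℝ (σ : Set E) := by
      rw [collinear_iff_of_mem (p₀ := a) (by exact_mod_cast ha)]
      refine ⟨b - a, fun p hp => ?_⟩
      rw [Finset.mem_coe, hσ3] at hp
      simp only [Finset.mem_insert, Finset.mem_singleton] at hp
      rcases hp with rfl | rfl | rfl
      · exact ⟨0, by simp⟩
      · exact ⟨1, by simp⟩
      · exact ⟨t, by simp [ht]⟩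
    have : FiniteDimensional ℝ (vectorSpan ℝ (σ : Set E)) :=
      finiteDimensional_vectorSpan_of_finite ℝ σ.finite_toSet
    have h1 := collinear_iff_finrank_le_one.1 hcol
    have h2 := finrank_vectorSpan_add_one_of_affineIndependent (hV.affineIndependent σ hσ) ⟨a, ha⟩
    have h3 := Finset.card_lt_card hss
    rw [Finset.card_pair hab] at h3
    omega
  obtain ⟨χ₀, hχ₀c, hχ₀⟩ := Submodule.exists_le_ker_of_notMem hnot
  have hχ₀b : χ₀ (b - a) = 0 := hχ₀ (Submodule.mem_span_singleton_self _)
  obtain ⟨χ, hχb, hχc⟩ : ∃ χ : E →ₗ[ℝ] ℝ, χ (b - a) = 0 ∧ χ (c - a) < 0 := by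
    rcases hχ₀c.lt_or_gt with h | h
    · exact ⟨χ₀, hχ₀b, h⟩
    · exact ⟨-χ₀, by rw [LinearMap.neg_apply, hχ₀b, neg_zero],
        by rw [LinearMap.neg_apply]; linarith⟩
  obtain ⟨θ, hθ⟩ := hσ.exists_functional ha
  have hθ' : ∀ x ∈ V, x ∉ σ → θ (x - a) < 0 := fun x hx hxσ =>
    lt_of_le_of_ne (hθ x hx).1 fun h => hxσ ((hθ x hx).2.1 h)
  -- The supporting functional is tilted by `χ`, which vanishes at `b` and is negative at `c`; `N`
  -- is large enough to keep points outside `σ` strictly negative.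
  obtain ⟨N, hN⟩ : ∃ N : ℝ, ∀ x ∈ V \ σ, χ (x - a) / (-θ (x - a)) < N := by
    obtain ⟨M, hM⟩ := ((V \ σ).image fun x => χ (x - a) / (-θ (x - a))).exists_le
    exact ⟨M + 1, fun x hx => lt_of_le_of_lt (hM _ (Finset.mem_image_of_mem _ hx)) (lt_add_one M)⟩
  refine ⟨lt_of_le_of_lt hsub hσ.1, N • θ + χ, (N • θ + χ) a, fun x hx => ?_⟩
  rw [← sub_nonpos, ← sub_eq_zero, ← map_sub]
  simp only [LinearMap.add_apply, LinearMap.smul_apply, smul_eq_mul]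
  by_cases hxσ : x ∈ σ
  · rw [(hθ x hx).2.2 hxσ]
    rw [hσ3] at hxσ
    simp only [Finset.mem_insert, Finset.mem_singleton] at hxσ
    rcases hxσ with rfl | rfl | rfl
    · simp
    · simp [hχb]
    · simp only [mul_zero, zero_add]
      exact ⟨hχc.le, fun h => absurd h hχc.ne, fun h => absurd h hcab⟩
  · have h1 := hN x (Finset.mem_sdiff.2 ⟨hx, hxσ⟩)
    rw [div_lt_iff₀ (by linarith [hθ' x hx hxσ])] at h1
    exact ⟨by linarith, fun h => by linarith, fun h => absurd (hsub h) hxσ⟩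

/-- A vertex that is neither lowest nor highest is the middle vertex of exactly two triangles. -/
theorem card_triangles_middle (hV : IsSimplicialConfiguration V) {l : E →ₗ[ℝ] ℝ}
    (hl : Set.InjOn l V) {v : E} (hv : v ∈ middlePoints l V) :
    ((triangles V).filter fun σ => v ∈ middlePoints l σ).card = 2 :=
  le_antisymm hV.triangles_middle_le_two (hV.two_le_triangles_middle hl hv)

/-! ### Counting triangles and edges. -/

theorem four_le_card (hV : IsSimplicialConfiguration V) : 4 ≤ V.card := by
  have hne : V.Nonempty := by
    rw [Finset.nonempty_iff_ne_empty]
    rintro rfl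
    have := hV.finrank_vectorSpan
    rw [Finset.coe_empty, vectorSpan_empty, finrank_bot] at this
    omega
  have hpos := Finset.card_pos.2 hne
  have h := finrank_vectorSpan_range_le ℝ (fun x : V => (x : E)) (n := V.card - 1)
    (by simp; omega)
  rw [Subtype.range_coe_subtype] at h
  have h' := hV.finrank_vectorSpan
  change finrank ℝ (vectorSpan ℝ {x | x ∈ V}) = 3 at h'
  omega

/-- Double count of pairs (triangle, middle vertex): one per triangle, two for each of the n - 2
vertices strictly between the extremes of `l`. -/
theorem card_triangles (hV : IsSimplicialConfiguration V) :
    (triangles V).card + 4 = 2 * V.card := by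
  have h4 := hV.four_le_card
  obtain ⟨l, hl⟩ := Module.exists_dual_forall_apply_ne_zero (K := ℝ)
    (fun p : (V.offDiag : Finset (E × E)) => p.1.1 - p.1.2) (fun p => by
      have := (Finset.mem_offDiag.1 p.2).2.2
      exact sub_ne_zero.2 this)
  have hl : Set.InjOn l V := by
    intro x hx y hy hxy
    by_contra hne
    exact hl ⟨(x, y), Finset.mem_offDiag.2 ⟨hx, hy, hne⟩⟩ (by simp [hxy])
  have hsum := Finset.sum_card_bipartiteAbove_eq_sum_card_bipartiteBelow
    (s := triangles V) (t := V) (fun σ v => v ∈ middlePoints l σ)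
  have h1 : ∀ σ ∈ triangles V,
      (Finset.bipartiteAbove (fun σ v => v ∈ middlePoints l σ) V σ).card = 1 := by
    intro σ hσ
    obtain ⟨hσ, hσ3⟩ := mem_triangles.1 hσ
    have : Finset.bipartiteAbove (fun σ v => v ∈ middlePoints l σ) V σ = middlePoints l σ := by
      ext v
      simp only [Finset.mem_bipartiteAbove, and_iff_right_iff_imp]
      exact fun hv => hσ.1.1 (Finset.mem_filter.1 hv).1
    rw [this]
    have := card_middlePoints (hl.mono (by exact_mod_cast hσ.1.1)) (S := σ) (by omega)
    omega
  have h2 : ∀ v ∈ V, (Finset.bipartiteBelow (fun σ v => v ∈ middlePoints l σ)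
      (triangles V) v).card = if v ∈ middlePoints l V then 2 else 0 := by
    intro v hv
    split_ifs with hm
    · exact hV.card_triangles_middle hl hm
    · rw [Finset.card_eq_zero, Finset.eq_empty_iff_forall_notMem]
      intro σ hσ
      obtain ⟨hσ, hvσ⟩ := (Finset.mem_bipartiteBelow _).1 hσ
      have hσV := (mem_triangles.1 hσ).1.1.1
      obtain ⟨-, ⟨a, ha, hav⟩, b, hb, hvb⟩ := Finset.mem_filter.1 hvσ
      exact hm (Finset.mem_filter.2 ⟨hv, ⟨a, hσV ha, hav⟩, b, hσV hb, hvb⟩)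
  rw [Finset.sum_congr rfl h1, Finset.sum_congr rfl h2, ← Finset.sum_filter] at hsum
  have h3 : V.filter (fun v => v ∈ middlePoints l V) = middlePoints l V := by
    ext v
    simp only [Finset.mem_filter, and_iff_right_iff_imp]
    exact fun hv => (Finset.mem_filter.1 hv).1
  rw [h3] at hsum
  simp only [Finset.sum_const, smul_eq_mul, mul_one] at hsum
  have h5 := card_middlePoints hl (by omega)
  omega

theorem card_edges_triangle (hV : IsSimplicialConfiguration V) {σ : Finset E}
    (hσ : σ ∈ triangles V) : ((edges V).filter fun e => e ⊆ σ).card = 3 := by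
  obtain ⟨hσ, hσ3⟩ := mem_triangles.1 hσ
  have : (edges V).filter (fun e => e ⊆ σ) = σ.powersetCard 2 := by
    ext e
    simp only [Finset.mem_filter, mem_edges, Finset.mem_powersetCard]
    constructor
    · rintro ⟨⟨-, h⟩, h'⟩
      exact ⟨h', h⟩
    · rintro ⟨h', h⟩
      obtain ⟨a, b, hab, rfl⟩ := Finset.card_eq_two.1 h
      exact ⟨⟨hV.isFaceSet_pair hσ (h' (by simp)) (h' (by simp)) hab, h⟩, h'⟩
  rw [this, Finset.card_powersetCard, hσ3]
  rfl

/-- A simplicial configuration with `n` points has `3 n - 6` edges. -/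
theorem card_edges (hV : IsSimplicialConfiguration V) : (edges V).card + 6 = 3 * V.card := by
  have hsum := Finset.sum_card_bipartiteAbove_eq_sum_card_bipartiteBelow
    (s := triangles V) (t := edges V) (fun σ e => e ⊆ σ)
  have h1 : ∀ σ ∈ triangles V,
      (Finset.bipartiteAbove (fun σ e => e ⊆ σ) (edges V) σ).card = 3 :=
    fun σ hσ => hV.card_edges_triangle hσ
  have h2 : ∀ e ∈ edges V,
      (Finset.bipartiteBelow (fun σ e => e ⊆ σ) (triangles V) e).card = 2 :=
    fun e he => hV.card_triangles_edge he
  rw [Finset.sum_congr rfl h1, Finset.sum_congr rfl h2] at hsum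
  simp only [Finset.sum_const, smul_eq_mul] at hsum
  have := hV.card_triangles
  omega

end IsSimplicialConfiguration

end FaceSets

/-! ### Reduced homology of a complex on two vertices. -/

namespace SimplicialHomology

open Module

variable {α : Type*} (k : Type*) [Field k]

theorem cycles_pair {K : Set (Set α)} {a b : α} (hK : ∀ F ∈ K, F ⊆ {a, b}) (ha : {a} ∈ K)
    (hb : {b} ∈ K) :
    cycles k K 0 = Submodule.span k {Finsupp.single [a] 1 - Finsupp.single [b] (1 : k)} := by
  have hsingle : ∀ x : α, {v | v ∈ [x]} = ({x} : Set α) := fun x => by ext; simp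
  have hbd : ∀ x : α, boundary k (Finsupp.single [x] 1) = Finsupp.single [] 1 := fun x => by
    rw [boundary_single]; simp
  have hset : {t : List α | (t.length : ℤ) = 0 + 1 ∧ {v | v ∈ t} ∈ K} = {[a], [b]} := by
    ext t
    simp only [Set.mem_ofPred_eq, Set.mem_insert_iff, Set.mem_singleton_iff]
    constructor
    · rintro ⟨h1, h2⟩
      obtain ⟨x, rfl⟩ := List.length_eq_one_iff.1 (by exact_mod_cast h1 : t.length = 1)
      simpa using hK _ h2 (show x ∈ {v | v ∈ [x]} by simp)
    · rintro (rfl | rfl)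
      · exact ⟨rfl, by rwa [hsingle]⟩
      · exact ⟨rfl, by rwa [hsingle]⟩
  have hchains : chains k K 0 =
      Submodule.span k {Finsupp.single [a] (1 : k), Finsupp.single [b] 1} := by
    rw [chains, hset, Finsupp.supported_eq_span_single, Set.image_pair]
  ext c
  rw [cycles, hchains, Submodule.mem_inf, Submodule.mem_span_pair, Submodule.mem_span_singleton,
    LinearMap.mem_ker]
  constructor
  · rintro ⟨⟨r, s, rfl⟩, h⟩
    rw [map_add, map_smul, map_smul, hbd, hbd, ← add_smul, smul_eq_zero] at h
    have h := h.resolve_right (by simp)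
    refine ⟨r, ?_⟩
    rw [smul_sub, sub_eq_add_neg, ← neg_smul, eq_neg_of_add_eq_zero_right h]
  · rintro ⟨r, rfl⟩
    refine ⟨⟨r, -r, ?_⟩, ?_⟩
    · rw [smul_sub, sub_eq_add_neg, ← neg_smul]
    · rw [map_smul, map_sub, hbd, hbd, sub_self, smul_zero]

theorem finrank_subquotient_of_comap_eq_top {M : Type*} [AddCommGroup M] [Module k M]
    {Z B : Submodule k M} (h : B.comap Z.subtype = ⊤) : finrank k (Subquotient k Z B) = 0 := by
  have := Submodule.Quotient.subsingleton_iff.2 h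
  exact finrank_zero_of_subsingleton

theorem finrank_subquotient_of_comap_eq_bot {M : Type*} [AddCommGroup M] [Module k M]
    {Z B : Submodule k M} (h : B.comap Z.subtype = ⊥) :
    finrank k (Subquotient k Z B) = finrank k Z :=
  (Submodule.quotEquivOfEqBot _ h).finrank_eq

theorem boundary_pair (x y : α) : boundary k (Finsupp.single [x, y] 1) =
    Finsupp.single [y] 1 - Finsupp.single [x] (1 : k) := by
  rw [boundary_single]
  simp [Finset.sum_range_succ, sub_eq_add_neg]

open scoped Classical in
/-- Reduced homology in degree `0` of a complex with vertex set `{a, b}`. -/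
theorem finrank_reducedHomology_pair {K : Set (Set α)} {a b : α} (hab : a ≠ b)
    (hK : ∀ F ∈ K, F ⊆ {a, b}) (ha : {a} ∈ K) (hb : {b} ∈ K) :
    finrank k (ReducedHomology k K 0) = if {a, b} ∈ K then 0 else 1 := by
  have hcyc := cycles_pair k hK ha hb
  split_ifs with h
  · have htop : (boundaries k K 0).comap (cycles k K 0).subtype = ⊤ := by
      rw [Submodule.comap_subtype_eq_top, hcyc, Submodule.span_singleton_le_iff_mem, boundaries]
      refine ⟨Finsupp.single [b, a] 1, Finsupp.single_mem_supported k 1 ⟨rfl, ?_⟩,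
        boundary_pair k b a⟩
      convert h using 1
      ext v
      simp [or_comm]
    exact finrank_subquotient_of_comap_eq_top k htop
  -- Without the edge, the only 1-chains are combinations of degenerate tuples `[x, x]`, whose
  -- boundary is zero.
  · have hbot : boundaries k K 0 = ⊥ := by
      rw [boundaries, chains, Finsupp.supported_eq_span_single, Submodule.map_span,
        Submodule.span_eq_bot]
      rintro _ ⟨_, ⟨t, ⟨ht, htK⟩, rfl⟩, rfl⟩
      obtain ⟨x, y, rfl⟩ := List.length_eq_two.1 (by exact_mod_cast ht : t.length = 2)
      rw [boundary_pair, sub_eq_zero]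
      have hx := hK _ htK (show x ∈ {v | v ∈ [x, y]} by simp)
      have hy := hK _ htK (show y ∈ {v | v ∈ [x, y]} by simp)
      by_contra hne
      have hxy : x ≠ y := fun h => hne (by rw [h])
      apply h
      convert htK using 1
      ext v
      simp only [Set.mem_insert_iff, Set.mem_singleton_iff] at hx hy
      rcases hx with rfl | rfl <;> rcases hy with rfl | rfl <;> simp_all [or_comm]
    have hbot' : (boundaries k K 0).comap (cycles k K 0).subtype = ⊥ := by
      rw [hbot, Submodule.comap_bot, Submodule.ker_subtype]
    rw [finrank_subquotient_of_comap_eq_bot k hbot', hcyc, finrank_span_singleton]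
    intro h0
    have := DFunLike.congr_fun h0 [a]
    simp [hab.symm] at this

end SimplicialHomology

/-! ### From polytopes to their vertex configurations. -/

namespace ConvexPolytope

section

variable {E : Type*} [NormedAddCommGroup E] [NormedSpace ℝ E]

theorem mem_vertices {P : ConvexPolytope E} {v : E} :
    v ∈ P.vertices ↔ v ∈ P.carrier.exposedPoints ℝ := by
  simp [vertices]

/-- Krein–Milman; the closure is superfluous because there are finitely many extreme points. -/
theorem convexHull_extremePoints (P : ConvexPolytope E) :
    convexHull ℝ (P.carrier.extremePoints ℝ) = P.carrier := by
  obtain ⟨S, hS⟩ := P.exists_eq_convexHull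
  have hfin : (P.carrier.extremePoints ℝ).Finite :=
    S.finite_toSet.subset (by rw [hS]; exact extremePoints_convexHull_subset)
  rw [← (hfin.isClosed_convexHull (𝕜 := ℝ)).closure_eq]
  refine closure_convexHull_extremePoints ?_ ?_
  · rw [hS]; exact S.finite_toSet.isCompact_convexHull (𝕜 := ℝ)
  · rw [hS]; exact convex_convexHull ℝ _

theorem convex_carrier (P : ConvexPolytope E) : Convex ℝ P.carrier := by
  rw [← P.convexHull_extremePoints]
  exact convex_convexHull ℝ _

/-- The extreme points of a polytope are exposed. -/
theorem exposedPoints_eq_extremePoints (P : ConvexPolytope E) :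
    P.carrier.exposedPoints ℝ = P.carrier.extremePoints ℝ := by
  refine exposedPoints_subset_extremePoints.antisymm fun x hx => ?_
  obtain ⟨S, hS⟩ := P.exists_eq_convexHull
  have hfin : (P.carrier.extremePoints ℝ).Finite :=
    S.finite_toSet.subset (by rw [hS]; exact extremePoints_convexHull_subset)
  set T := P.carrier.extremePoints ℝ \ {x} with hT
  have hxT : x ∉ convexHull ℝ T := fun h =>
    (P.convex_carrier.mem_extremePoints_iff_mem_sdiff_convexHull_sdiff.1 hx).2
      (convexHull_mono (Set.sdiff_subset_sdiff_left extremePoints_subset) h)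
  -- A functional separating `x` from the hull of the other extreme points exposes `x`: every point
  -- of `P` is a convex combination of `x` and a point of that hull.
  obtain ⟨f, u, hfu, hux⟩ := geometric_hahn_banach_closed_point (convex_convexHull ℝ T)
    ((hfin.subset Set.sdiff_subset).isClosed_convexHull (𝕜 := ℝ)) hxT
  refine ⟨hx.1, f, fun y hy => ?_⟩
  rw [← P.convexHull_extremePoints, ← Set.insert_sdiff_self_of_mem hx, ← hT] at hy
  rcases T.eq_empty_or_nonempty with h0 | hne
  · have : y = x := by simpa [h0] using hy
    simp [this]
  rw [convexHull_insert hne, convexJoin_singleton_left, Set.mem_iUnion₂] at hy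
  obtain ⟨z, hz, p, q, hp, hq, hpq, rfl⟩ := hy
  have hzx : f z < f x := (hfu z hz).trans hux
  have hfy : f (p • x + q • z) = f x - q * (f x - f z) := by
    rw [map_add, map_smul, map_smul, smul_eq_mul, smul_eq_mul, eq_sub_of_add_eq hpq]
    ring
  rw [hfy]
  refine ⟨by nlinarith, fun h => ?_⟩
  have hq0 : q = 0 := by nlinarith
  have hp1 : p = 1 := by linarith
  simp [hq0, hp1]

theorem convexHull_vertices (P : ConvexPolytope E) :
    convexHull ℝ (P.vertices : Set E) = P.carrier := by
  have : (P.vertices : Set E) = P.carrier.extremePoints ℝ := by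
    rw [← exposedPoints_eq_extremePoints]
    ext v
    exact mem_vertices
  rw [this, convexHull_extremePoints]

theorem vertices_subset (P : ConvexPolytope E) : (P.vertices : Set E) ⊆ P.carrier := by
  rw [← P.convexHull_vertices]
  exact subset_convexHull ℝ _

theorem forall_le_of_vertices {P : ConvexPolytope E} (θ : E →ₗ[ℝ] ℝ) {c : ℝ}
    (h : ∀ x ∈ P.vertices, θ x ≤ c) : ∀ x ∈ P.carrier, θ x ≤ c := by
  rw [← P.convexHull_vertices]
  exact convexHull_min h (convex_halfSpace_le θ.isLinear c)

theorem isFaceSet_of_isProperFace {P : ConvexPolytope E} {F : Set E} (hF : P.IsProperFace F)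
    {σ : Finset E} (hσ : (σ : Set E) = F ∩ P.vertices) : IsFaceSet P.vertices σ := by
  have hmem : ∀ x ∈ P.vertices, (x ∈ σ ↔ x ∈ F) := fun x hx => by
    rw [← Finset.mem_coe, hσ]
    simp [hx]
  have hsub : σ ⊆ P.vertices := fun x hx => by
    rw [← Finset.mem_coe, hσ] at hx
    exact hx.2
  rcases F.eq_empty_or_nonempty with rfl | hne
  · have hσ0 : σ = ∅ := by simpa using hσ
    subst hσ0
    -- The zero functional never reaches the bound 1, which encodes the empty face.
    refine ⟨lt_of_le_of_ne hsub fun h => hF.2 ?_, 0, 1, fun x hx => by simp⟩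
    rw [← P.convexHull_vertices, ← h]
    simp
  obtain ⟨l, hl⟩ := hF.1 hne
  obtain ⟨p, hp⟩ := hne
  have hp' := hp
  rw [hl] at hp'
  have key : ∀ x ∈ P.carrier, l x ≤ l p ∧ (l x = l p ↔ x ∈ F) := by
    intro x hx
    refine ⟨hp'.2 x hx, fun h => ?_, fun h => ?_⟩
    · rw [hl]
      exact ⟨hx, fun y hy => h ▸ hp'.2 y hy⟩
    · rw [hl] at h
      exact le_antisymm (hp'.2 x hx) (h.2 p hp'.1)
  refine ⟨lt_of_le_of_ne hsub fun h => hF.2 ?_, l.toLinearMap, l p, fun x hx => ?_⟩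
  · refine Set.Subset.antisymm hF.1.subset fun x hx => ((key x hx).2).1 ?_
    refine le_antisymm (key x hx).1 ?_
    have := forall_le_of_vertices (P := P) (-l.toLinearMap) (c := -l p) (fun v hv => by
      have := (key v (P.vertices_subset hv)).2.2 ((hmem v hv).1 (h ▸ hv))
      simp [this]) x hx
    simpa using this
  · rw [hmem x hx]
    exact key x (P.vertices_subset hx)

/-- The face is the set of maximisers of `θ` on `P`; finite dimension makes `θ` continuous, as
exposed sets require. -/
theorem exists_isProperFace [FiniteDimensional ℝ E] {P : ConvexPolytope E} {σ : Finset E}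
    (hσ : IsFaceSet P.vertices σ) :
    ∃ F, P.IsProperFace F ∧ (σ : Set E) = F ∩ P.vertices := by
  obtain ⟨hss, θ, c, hθ⟩ := hσ
  obtain ⟨w, hw, hwσ⟩ := Finset.exists_of_ssubset hss
  rcases σ.eq_empty_or_nonempty with rfl | ⟨s, hs⟩
  · refine ⟨∅, ⟨fun h => absurd h Set.not_nonempty_empty, fun h => ?_⟩, by simp⟩
    have := P.vertices_subset hw
    rw [← h] at this
    exact this
  have hle := forall_le_of_vertices θ fun x hx => (hθ x hx).1
  have hsV := hss.1 hs
  have hsc := (hθ s hsV).2.2 hs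
  have key : ∀ x ∈ P.vertices, (x ∈ σ ↔ x ∈ {x ∈ P.carrier | ∀ y ∈ P.carrier, θ y ≤ θ x}) := by
    intro x hx
    rw [← (hθ x hx).2]
    refine ⟨fun h => ⟨P.vertices_subset hx, fun y hy => h ▸ hle y hy⟩, fun h => ?_⟩
    exact le_antisymm (hθ x hx).1 (hsc ▸ h.2 s (P.vertices_subset hsV))
  refine ⟨{x ∈ P.carrier | ∀ y ∈ P.carrier, θ y ≤ θ x},
    ⟨fun _ => ⟨LinearMap.toContinuousLinearMap θ, rfl⟩, fun h => ?_⟩, ?_⟩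
  · exact hwσ ((key w hw).2 (by rw [h]; exact P.vertices_subset hw))
  · ext x
    simp only [Finset.mem_coe, Set.mem_inter_iff]
    exact ⟨fun h => ⟨(key x (hss.1 h)).1 h, hss.1 h⟩, fun h => (key x h.2).2 h.1⟩

theorem mem_boundaryComplex [FiniteDimensional ℝ E] {P : ConvexPolytope E} {s : Set E} :
    s ∈ P.boundaryComplex ↔ ∃ σ : Finset E, IsFaceSet P.vertices σ ∧ (σ : Set E) = s := by
  constructor
  · rintro ⟨F, hF, rfl⟩
    have hfin : (F ∩ P.vertices).Finite := P.vertices.finite_toSet.subset Set.inter_subset_right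
    exact ⟨hfin.toFinset, isFaceSet_of_isProperFace hF (by simp), by simp⟩
  · rintro ⟨σ, hσ, rfl⟩
    exact exists_isProperFace hσ

theorem isSimplicialConfiguration [FiniteDimensional ℝ E] {P : ConvexPolytope E}
    (hdim : P.dim = 3) (hsimp : P.IsSimplicial) : IsSimplicialConfiguration P.vertices := by
  have hrank : Module.finrank ℝ (vectorSpan ℝ (P.vertices : Set E)) = 3 := by
    rw [← hdim, dim, ← direction_affineSpan, ← P.convexHull_vertices, affineSpan_convexHull]
  refine ⟨hrank, fun σ hσ => ?_, fun v hv => ?_⟩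
  · obtain ⟨F, hF, hσF⟩ := exists_isProperFace hσ
    obtain ⟨S, hS, hFS⟩ := hsimp F hF
    -- A vertex of `P` in `F` is extreme in `F`, hence among the points spanning the simplex.
    have hsub : (σ : Set E) ⊆ (S : Set E) := by
      rw [hσF]
      rintro x ⟨hxF, hxV⟩
      have hx : x ∈ F.extremePoints ℝ := inter_extremePoints_subset_extremePoints_of_subset
        hF.1.subset ⟨hxF, exposedPoints_subset_extremePoints (mem_vertices.1 hxV)⟩
      rw [hFS] at hx
      exact extremePoints_convexHull_subset hx
    exact AffineIndependent.mono (t := (S : Set E)) hS hsub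
  · obtain ⟨hvP, l, hl⟩ := mem_vertices.1 hv
    refine ⟨lt_of_le_of_ne (by simpa using hv) fun h => ?_, l.toLinearMap, l v, fun x hx => ?_⟩
    · rw [← h, Finset.coe_singleton, vectorSpan_singleton, finrank_bot] at hrank
      omega
    · have := hl x (P.vertices_subset hx)
      rw [Finset.mem_singleton]
      exact ⟨this.1, fun h => this.2 h.ge, fun h => by rw [h]; rfl⟩

open scoped Classical in
/-- The second special Betti number counts the pairs of vertices that are not edges. -/
theorem specialBetti_two_add_card_edges [FiniteDimensional ℝ E] {P : ConvexPolytope E}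
    (hdim : P.dim = 3) (hsimp : P.IsSimplicial) (k : Type*) [Field k] :
    P.specialBetti k 2 + (edges P.vertices).card = P.vertices.card.choose 2 := by
  have hV := isSimplicialConfiguration hdim hsimp
  have hterm : ∀ W ∈ P.vertices.powersetCard 2,
      Module.finrank k (SimplicialHomology.ReducedHomology k
        (restrictComplex P.boundaryComplex (W : Set E)) (((2 : ℕ) : ℤ) - (((2 : ℕ) : ℤ) - 1) - 1)) =
      if W ∉ edges P.vertices then 1 else 0 := by
    intro W hW
    obtain ⟨hWV, hW2⟩ := Finset.mem_powersetCard.1 hW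
    obtain ⟨a, b, hab, rfl⟩ := Finset.card_eq_two.1 hW2
    have hd : (((2 : ℕ) : ℤ) - (((2 : ℕ) : ℤ) - 1) - 1) = 0 := by norm_num
    have hvert : ∀ v ∈ ({a, b} : Finset E), ({v} : Set E) ∈
        restrictComplex P.boundaryComplex (({a, b} : Finset E) : Set E) := fun v hv =>
      ⟨{v}, mem_boundaryComplex.2 ⟨{v}, hV.isFaceSet_singleton v (hWV hv), by simp⟩,
        (Set.inter_eq_left.2 (by simpa using hv)).symm⟩
    -- Membership only says that the pair lies in some face; `isFaceSet_pair` makes it a face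
    -- itself.
    have hedge : ({a, b} : Set E) ∈ restrictComplex P.boundaryComplex (({a, b} : Finset E) : Set E)
        ↔ {a, b} ∈ edges P.vertices := by
      rw [mem_edges]
      constructor
      · rintro ⟨F, hF, h⟩
        obtain ⟨σ, hσ, rfl⟩ := mem_boundaryComplex.1 hF
        have ha := h.subset (Set.mem_insert a {b})
        have hb := h.subset (Set.mem_insert_of_mem a (Set.mem_singleton b))
        exact ⟨hV.isFaceSet_pair hσ ha.1 hb.1 hab, hW2⟩
      · rintro ⟨h, -⟩
        exact ⟨_, mem_boundaryComplex.2 ⟨_, h, rfl⟩, by simp⟩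
    rw [hd, SimplicialHomology.finrank_reducedHomology_pair k hab ?_
      (hvert a (by simp)) (hvert b (by simp))]
    · simp only [hedge]
      split_ifs <;> rfl
    · rintro _ ⟨F, -, rfl⟩
      simp
  have hedges : (P.vertices.powersetCard 2).filter (fun W => W ∈ edges P.vertices) =
      edges P.vertices := by
    ext e
    simp only [Finset.mem_filter, and_iff_right_iff_imp]
    exact fun h => (Finset.mem_filter.1 h).1
  rw [specialBetti, gradedBetti, Finset.sum_congr rfl hterm, ← Finset.card_filter]
  have hsum := Finset.card_filter_add_card_filter_not (s := P.vertices.powersetCard 2)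
    (fun W => W ∈ edges P.vertices)
  rw [hedges, Finset.card_powersetCard] at hsum
  rw [add_comm, ← hsum]

end

end ConvexPolytope

theorem mainTheorem10 {m : ℕ} (P : ConvexPolytope (EuclideanSpace ℝ (Fin m)))
    (hdim : P.dim = 3) (hsimp : P.IsSimplicial)
    (n : ℕ) (hn : P.vertices.card = n) (k : Type*) [Field k] :
    (n : ℝ) = (7 + √(8 * (P.specialBetti k 2 : ℝ) + 1)) / 2 ∧
      (P.specialBetti k 2 : ℤ) = (n.choose 2 : ℤ) - 3 * (n : ℤ) + 6 := by
  have hV := ConvexPolytope.isSimplicialConfiguration hdim hsimp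
  have h1 := ConvexPolytope.specialBetti_two_add_card_edges hdim hsimp k
  have h2 := hV.card_edges
  have h4 := hV.four_le_card
  rw [hn] at h1 h2 h4
  refine ⟨?_, by omega⟩
  have hb : (P.specialBetti k 2 : ℝ) = n * (n - 1) / 2 - 3 * n + 6 := by
    rw [← Nat.cast_choose_two ℝ n]
    have h1' : (P.specialBetti k 2 : ℝ) + (edges P.vertices).card = (n.choose 2 : ℕ) := by
      exact_mod_cast h1
    have h2' : ((edges P.vertices).card : ℝ) + 6 = 3 * n := by exact_mod_cast h2
    linarith
  have h4' : (4 : ℝ) ≤ n := by exact_mod_cast h4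
  -- The square root is then `2 * n - 7`, which is positive because n ≥ 4.
  have hsq : 8 * (P.specialBetti k 2 : ℝ) + 1 = (2 * n - 7) ^ 2 := by
    rw [hb]
    ring
  rw [hsq, Real.sqrt_sq (by linarith)]
  ring
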